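/- For a positive integer $n$, let $M(n)$ denote the maximum size of a family of simple graphs on the vertex set $[n]=\{1,\dots,n\}$ such that for any two different members $G,G'$ of the family the graph on $[n]$ with edge set $(E(G)\setminus E(G'))\cup(E(G')\setminus E(G))$ contains a Hamiltonian cycle. A perfect $1$-factorization of a graph is a partition of its edge set into perfect matchings such that the union of any two different ones of them is a Hamiltonian cycle. Theorem. For every positive even integer $n$ for which the complete graph $K_n$ has a perfect $1$-factorization, $M(n)=2^{n-2}$. In particular, this is the case if $n=p+1$ or $n=2p$ for some odd prime $p$: for these $n$ the graph $K_n$ has a perfect $1$-factorization, and hence $M(n)=2^{n-2}$. -/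

import Mathlib

open scoped symmDiff

/-- A family of (simple) graphs on the labelled vertex set `Fin n` is `F`-good if the symmetric
difference of any two different members of the family belongs to the graph class `F`. A graph class
is given by the graphs it contains on each vertex set `Fin n`. -/
def IsGoodFamily (F : (n : ℕ) → Set (SimpleGraph (Fin n))) {n : ℕ}
    (𝒢 : Finset (SimpleGraph (Fin n))) : Prop :=
  ∀ G ∈ 𝒢, ∀ G' ∈ 𝒢, G ≠ G' → G ∆ G' ∈ F n

/-- `M_F(n)`: the maximum size of an `F`-good family of graphs on `n` labelled vertices. -/
noncomputable def maxGoodFamily (F : (n : ℕ) → Set (SimpleGraph (Fin n))) (n : ℕ) : ℕ :=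
  sSup {k : ℕ | ∃ 𝒢 : Finset (SimpleGraph (Fin n)), IsGoodFamily F 𝒢 ∧ 𝒢.card = k}

/-- The supremum in the definition of `maxGoodFamily` is a maximum. -/
theorem isGreatest_maxGoodFamily (F : (n : ℕ) → Set (SimpleGraph (Fin n))) (n : ℕ) :
    IsGreatest {k : ℕ | ∃ 𝒢 : Finset (SimpleGraph (Fin n)), IsGoodFamily F 𝒢 ∧ 𝒢.card = k}
      (maxGoodFamily F n) := by
  classical
  have hb : BddAbove
      {k : ℕ | ∃ 𝒢 : Finset (SimpleGraph (Fin n)), IsGoodFamily F 𝒢 ∧ 𝒢.card = k} := by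
    refine ⟨Fintype.card (SimpleGraph (Fin n)), ?_⟩
    rintro k ⟨𝒢, -, rfl⟩
    exact 𝒢.card_le_univ
  exact ⟨Nat.sSup_mem ⟨0, ∅, by simp [IsGoodFamily], rfl⟩ hb, fun k hk => le_csSup hb hk⟩

/-- The class of graphs containing a Hamiltonian cycle. -/
def hamiltonianCycleClass (n : ℕ) : Set (SimpleGraph (Fin n)) :=
  {G | ∃ (a : Fin n) (p : G.Walk a a), p.IsHamiltonianCycle}

/-- A perfect 1-factorization of `G`: a set of perfect matchings of `G` such that every edge of `G`
lies in exactly one of them, and the union of any two different ones is a Hamiltonian cycle. -/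
structure IsPerfectOneFactorization {V : Type*} [DecidableEq V] (G : SimpleGraph V)
    (ℳ : Set G.Subgraph) : Prop where
  isPerfectMatching : ∀ M ∈ ℳ, M.IsPerfectMatching
  existsUnique_mem : ∀ e ∈ G.edgeSet, ∃! M : G.Subgraph, M ∈ ℳ ∧ e ∈ M.edgeSet
  sup_eq_hamiltonianCycle : ∀ M ∈ ℳ, ∀ M' ∈ ℳ, M ≠ M' →
    ∃ (a : V) (p : G.Walk a a), p.IsHamiltonianCycle ∧ p.toSubgraph = M ⊔ M'

/-- The complete graph `K_n` has a perfect 1-factorization. -/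
def CompleteGraphHasPerfectOneFactorization (n : ℕ) : Prop :=
  ∃ ℳ : Set (⊤ : SimpleGraph (Fin n)).Subgraph,
    IsPerfectOneFactorization (⊤ : SimpleGraph (Fin n)) ℳ

open SimpleGraph

/-- The subgraph of the complete graph whose edges are the two-element orbits of `f`. -/
def involutionSubgraph {V : Type*} (f : V → V) : (⊤ : SimpleGraph V).Subgraph where
  verts := Set.univ
  Adj x y := x ≠ y ∧ f x = y ∧ f y = x
  adj_sub h := h.1
  edge_vert _ := Set.mem_univ _
  symm := ⟨fun _ _ h => ⟨h.1.symm, h.2.2, h.2.1⟩⟩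

/-- A family of fixed-point-free involutions such that any two points are exchanged by exactly one
of them, and any two of them generate a transitive group. -/
structure IsPerfectInvolutionFamily {V ι : Type*} (F : ι → V → V) : Prop where
  involutive : ∀ i, Function.Involutive (F i)
  apply_ne : ∀ i x, F i x ≠ x
  exists_apply_eq : ∀ x y, x ≠ y → ∃ i, F i x = y
  apply_injective : ∀ x i j, F i x = F j x → i = j
  eq_univ : ∀ i j, i ≠ j → ∀ S : Set V, S.Nonempty → (∀ x ∈ S, F i x ∈ S) → (∀ x ∈ S, F j x ∈ S) →
    S = Set.univ

namespace IsPerfectInvolutionFamily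

variable {V ι : Type*} {F : ι → V → V}

theorem conj {W : Type*} (hF : IsPerfectInvolutionFamily F) (e : V ≃ W) :
    IsPerfectInvolutionFamily (fun i w => e (F i (e.symm w))) where
  involutive i w := by simp [hF.involutive i _]
  apply_ne i w h := hF.apply_ne i (e.symm w) (by simpa [Equiv.eq_symm_apply] using h)
  exists_apply_eq x y h := by
    obtain ⟨i, hi⟩ := hF.exists_apply_eq (e.symm x) (e.symm y) (by simpa using h)
    exact ⟨i, by simp [hi]⟩
  apply_injective x i j h := hF.apply_injective (e.symm x) i j (by simpa using h)
  eq_univ i j hij S hS hi hj := by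
    have h := hF.eq_univ i j hij (e ⁻¹' S) (hS.preimage e.surjective)
      (fun x hx => by simpa using hi _ hx) (fun x hx => by simpa using hj _ hx)
    rwa [Set.preimage_eq_univ_iff, e.range_eq_univ, Set.univ_subset_iff] at h

theorem involutionSubgraph_adj (hF : IsPerfectInvolutionFamily F) {i : ι} {x y : V} :
    (involutionSubgraph (F i)).Adj x y ↔ F i x = y := by
  refine ⟨fun h => h.2.1, ?_⟩
  rintro rfl
  exact ⟨(hF.apply_ne i x).symm, rfl, hF.involutive i x⟩

theorem isPerfectMatching (hF : IsPerfectInvolutionFamily F) (i : ι) :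
    (involutionSubgraph (F i)).IsPerfectMatching := by
  rw [Subgraph.isPerfectMatching_iff]
  intro v
  simp [hF.involutionSubgraph_adj]

theorem exists_isHamiltonianCycle [Finite V] [DecidableEq V] (hF : IsPerfectInvolutionFamily F)
    [Nonempty V] {i j : ι} (hij : i ≠ j) :
    ∃ (a : V) (p : (⊤ : SimpleGraph V).Walk a a), p.IsHamiltonianCycle ∧
      p.toSubgraph = involutionSubgraph (F i) ⊔ involutionSubgraph (F j) := by
  classical
  have := Fintype.ofFinite V
  set H := (involutionSubgraph (F i)).spanningCoe ∆ (involutionSubgraph (F j)).spanningCoe with hH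
  have hcyc : H.IsCycles := (hF.isPerfectMatching i).symmDiff_isCycles (hF.isPerfectMatching j)
  have hadj : ∀ x y, H.Adj x y ↔ F i x = y ∨ F j x = y := by
    intro x y
    simp only [hH, symmDiff_def, sup_adj, sdiff_adj, Subgraph.spanningCoe_adj,
      hF.involutionSubgraph_adj]
    constructor
    · tauto
    · rintro (h | h)
      · exact Or.inl ⟨h, fun h' => hij (hF.apply_injective x i j (h.trans h'.symm))⟩
      · exact Or.inr ⟨h, fun h' => hij (hF.apply_injective x i j (h'.trans h.symm))⟩
  obtain ⟨a⟩ := ‹Nonempty V›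
  obtain ⟨q, hq, hqv⟩ := hcyc.exists_cycle_toSubgraph_verts_eq_connectedComponentSupp
    (c := H.connectedComponentMk a) (v := a) rfl ⟨F i a, (hadj _ _).2 (Or.inl rfl)⟩
  have hsupp : (H.connectedComponentMk a).supp = Set.univ := by
    have hstep : ∀ x ∈ (H.connectedComponentMk a).supp, ∀ y, H.Adj x y →
        y ∈ (H.connectedComponentMk a).supp := fun x hx y hxy =>
      (ConnectedComponent.sound hxy.symm.reachable).trans hx
    exact hF.eq_univ i j hij _ ⟨a, rfl⟩
      (fun x hx => hstep x hx _ ((hadj _ _).2 (Or.inl rfl)))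
      (fun x hx => hstep x hx _ ((hadj _ _).2 (Or.inr rfl)))
  rw [hsupp] at hqv
  have hmem : ∀ x, x ∈ q.toSubgraph.verts := fun x => hqv ▸ Set.mem_univ x
  have hle : H ≤ ⊤ := le_top
  refine ⟨a, q.mapLe hle, ?_, ?_⟩
  · rw [Walk.isHamiltonianCycle_isCycle_and_isHamiltonian_tail]
    have hc : (q.mapLe hle).IsCycle := hq.mapLe hle
    refine ⟨hc, hc.isPath_tail.isHamiltonian_of_mem fun w => ?_⟩
    rw [Walk.support_tail_of_not_nil _ hc.not_nil]
    have hw : w ∈ (q.mapLe hle).support := by simpa using hmem w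
    rw [Walk.mem_support_iff] at hw
    rcases hw with rfl | hw
    · exact Walk.end_mem_tail_support hc.not_nil
    · exact hw
  · ext x y
    · simp only [Walk.mem_verts_toSubgraph, Walk.support_mapLe_eq_support, Subgraph.verts_sup]
      simpa [involutionSubgraph] using hmem x
    · rw [Walk.adj_toSubgraph_mapLe, hq.adj_toSubgraph_iff_of_isCycles hcyc (hmem x), hadj,
        Subgraph.sup_adj, hF.involutionSubgraph_adj, hF.involutionSubgraph_adj]

theorem isPerfectOneFactorization [Finite V] [DecidableEq V] (hF : IsPerfectInvolutionFamily F)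
    [Nonempty V] :
    IsPerfectOneFactorization (⊤ : SimpleGraph V) (Set.range fun i => involutionSubgraph (F i)) where
  isPerfectMatching := by
    rintro _ ⟨i, rfl⟩
    exact hF.isPerfectMatching i
  existsUnique_mem e he := by
    induction e with | _ x y => ?_
    obtain ⟨i, hi⟩ := hF.exists_apply_eq x y he
    refine ⟨_, ⟨⟨i, rfl⟩, hF.involutionSubgraph_adj.2 hi⟩, ?_⟩
    rintro _ ⟨⟨j, rfl⟩, hj⟩
    rw [hF.apply_injective x j i ((hF.involutionSubgraph_adj.1 hj).trans hi.symm)]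
  sup_eq_hamiltonianCycle := by
    rintro _ ⟨i, rfl⟩ _ ⟨j, rfl⟩ hij
    exact hF.exists_isHamiltonianCycle fun h => hij (by rw [h])

theorem completeGraphHasPerfectOneFactorization [Fintype V] [Nonempty V]
    (hF : IsPerfectInvolutionFamily F) {n : ℕ} (hn : Fintype.card V = n) :
    CompleteGraphHasPerfectOneFactorization n := by
  have e : V ≃ Fin n := Fintype.equivFinOfCardEq hn
  have : Nonempty (Fin n) := e.symm.nonempty
  exact ⟨_, (hF.conj e).isPerfectOneFactorization⟩

end IsPerfectInvolutionFamily

theorem Set.eq_univ_of_add_mem_zmod {p : ℕ} [Fact p.Prime] {S : Set (ZMod p)} (hS : S.Nonempty)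
    {d : ZMod p} (hd : d ≠ 0) (h : ∀ x ∈ S, x + d ∈ S) : S = Set.univ := by
  obtain ⟨a, ha⟩ := hS
  have hk : ∀ k : ℕ, a + k * d ∈ S := by
    intro k
    induction k with
    | zero => simpa using ha
    | succ k ih => convert h _ ih using 1; push_cast; ring
  refine Set.eq_univ_of_forall fun x => ?_
  convert hk ((x - a) / d).val using 1
  rw [ZMod.natCast_zmod_val]
  field_simp
  ring

/-- A set that is closed under two different reflections of `ZMod p` is empty or everything. -/
theorem Set.eq_univ_of_reflection_mem_zmod {p : ℕ} [Fact p.Prime] (h2 : (2 : ZMod p) ≠ 0)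
    {S : Set (ZMod p)} (hS : S.Nonempty) {i j : ZMod p} (hij : i ≠ j)
    (hi : ∀ x ∈ S, 2 * i - x ∈ S) (hj : ∀ x ∈ S, 2 * j - x ∈ S) : S = Set.univ := by
  refine Set.eq_univ_of_add_mem_zmod hS (mul_ne_zero h2 (sub_ne_zero.2 hij.symm)) fun x hx => ?_
  convert hj _ (hi _ hx) using 1
  ring

theorem ZMod.two_ne_zero_of_odd {p : ℕ} [Fact p.Prime] (hp : Odd p) : (2 : ZMod p) ≠ 0 := by
  intro h
  have h' : ((2 : ℕ) : ZMod p) = 0 := by exact_mod_cast h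
  rw [ZMod.natCast_eq_zero_iff] at h'
  have := (Nat.prime_dvd_prime_iff_eq Fact.out Nat.prime_two).1 h'
  subst this
  exact absurd hp (by decide)

/-- The reflection of `ZMod p` at `i`, modified so that it exchanges `i` with a point at infinity. -/
def reflectionOption {p : ℕ} (i : ZMod p) : Option (ZMod p) → Option (ZMod p)
  | none => some i
  | some x => if x = i then none else some (2 * i - x)

theorem isPerfectInvolutionFamily_reflectionOption {p : ℕ} [Fact p.Prime]
    (h2 : (2 : ZMod p) ≠ 0) : IsPerfectInvolutionFamily (reflectionOption (p := p)) where
  involutive i x := by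
    rcases x with _ | x
    · simp [reflectionOption]
    · by_cases hx : x = i
      · simp [reflectionOption, hx]
      · have : 2 * i - x ≠ i := fun h => hx (by linear_combination -h)
        simp [reflectionOption, hx, this]
  apply_ne i x := by
    rcases x with _ | x
    · simp [reflectionOption]
    · by_cases hx : x = i
      · simp [reflectionOption, hx]
      · have : 2 * i - x ≠ x := fun h => hx (mul_left_cancel₀ h2 (by linear_combination -h))
        simp [reflectionOption, hx, this]
  exists_apply_eq x y hxy := by
    rcases x with _ | x <;> rcases y with _ | y
    · exact absurd rfl hxy
    · exact ⟨y, rfl⟩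
    · exact ⟨x, by simp [reflectionOption]⟩
    · have hne : x ≠ y := fun h => hxy (by rw [h])
      refine ⟨(x + y) / 2, ?_⟩
      have hx : x ≠ (x + y) / 2 := by
        intro h
        rw [eq_div_iff h2] at h
        exact hne (by linear_combination h)
      have h : 2 * ((x + y) / 2) - x = y := by field_simp; ring
      simp [reflectionOption, hx, h]
  apply_injective x i j h := by
    rcases x with _ | x
    · simpa [reflectionOption] using h
    · by_cases hi : x = i <;> by_cases hj : x = j
      · exact hi.symm.trans hj
      · simp [reflectionOption, hi] at h
        tauto
      · simp [reflectionOption, hj] at h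
        tauto
      · simp only [reflectionOption, hi, hj, if_false, Option.some.injEq] at h
        exact mul_left_cancel₀ h2 (by linear_combination h)
  eq_univ i j hij S hS hi hj := by
    have key : ∀ k, (∀ x ∈ S, reflectionOption k x ∈ S) → some k ∈ S →
        ∀ x ∈ some ⁻¹' S, 2 * k - x ∈ some ⁻¹' S := by
      intro k hk hkS x hx
      by_cases hxk : x = k
      · subst hxk
        convert hx using 1
        ring
      · simpa [reflectionOption, hxk] using hk _ hx
    have himp : none ∈ S → S = Set.univ := by
      intro hn
      have hU := Set.eq_univ_of_reflection_mem_zmod h2 (S := some ⁻¹' S) ⟨i, hi _ hn⟩ hij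
        (key i hi (hi _ hn)) (key j hj (hj _ hn))
      refine Set.eq_univ_of_forall fun x => ?_
      rcases x with _ | x
      · exact hn
      · exact (hU ▸ Set.mem_univ x : x ∈ some ⁻¹' S)
    by_contra hne
    have hn : none ∉ S := fun h => hne (himp h)
    have hnot : ∀ k, (∀ x ∈ S, reflectionOption k x ∈ S) → some k ∉ S := fun k hk hkS =>
      hn (by simpa [reflectionOption] using hk _ hkS)
    have key' : ∀ k, (∀ x ∈ S, reflectionOption k x ∈ S) →
        ∀ x ∈ some ⁻¹' S, 2 * k - x ∈ some ⁻¹' S := by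
      intro k hk x hx
      have hxk : x ≠ k := fun h => hnot k hk (h ▸ hx)
      simpa [reflectionOption, hxk] using hk _ hx
    obtain ⟨x, hx⟩ := hS
    rcases x with _ | x
    · exact hn hx
    · have hU := Set.eq_univ_of_reflection_mem_zmod h2 (S := some ⁻¹' S) ⟨x, hx⟩ hij
        (key' i hi) (key' j hj)
      exact hnot i hi (hU ▸ Set.mem_univ i : i ∈ some ⁻¹' S)

/-- On two copies of `ZMod p`, the reflection of both copies at `s`, modified so that it exchanges
the two copies of `s`; and, for `d ≠ 0`, the exchange of the two copies with translation by `d`. -/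
def reflectionOrSwap {p : ℕ} : ZMod p ⊕ {d : ZMod p // d ≠ 0} → ZMod p × Bool → ZMod p × Bool
  | .inl s, (x, b) => if x = s then (x, !b) else (2 * s - x, b)
  | .inr d, (x, false) => (x + d, true)
  | .inr d, (x, true) => (x - d, false)

theorem isPerfectInvolutionFamily_reflectionOrSwap {p : ℕ} [Fact p.Prime]
    (h2 : (2 : ZMod p) ≠ 0) : IsPerfectInvolutionFamily (reflectionOrSwap (p := p)) where
  involutive i x := by
    obtain ⟨x, b⟩ := x
    rcases i with s | d
    · by_cases hx : x = s
      · simp [reflectionOrSwap, hx]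
      · have : 2 * s - x ≠ s := fun h => hx (by linear_combination -h)
        simp [reflectionOrSwap, hx, this]
    · cases b <;> simp [reflectionOrSwap]
  apply_ne i x := by
    obtain ⟨x, b⟩ := x
    rcases i with s | d
    · by_cases hx : x = s
      · simp [reflectionOrSwap, hx]
      · have : 2 * s - x ≠ x := fun h => hx (mul_left_cancel₀ h2 (by linear_combination -h))
        simp [reflectionOrSwap, hx, this]
    · cases b <;> simp [reflectionOrSwap]
  exists_apply_eq x y hxy := by
    obtain ⟨x, b⟩ := x
    obtain ⟨y, c⟩ := y
    by_cases hne : x = y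
    · subst hne
      refine ⟨.inl x, ?_⟩
      have hbc : b ≠ c := fun h => hxy (by rw [h])
      simpa [reflectionOrSwap] using (Bool.eq_not.2 hbc.symm).symm
    · by_cases hbc : b = c
      · subst hbc
        refine ⟨.inl ((x + y) / 2), ?_⟩
        have hx : x ≠ (x + y) / 2 := by
          intro h
          rw [eq_div_iff h2] at h
          exact hne (by linear_combination h)
        have h : 2 * ((x + y) / 2) - x = y := by field_simp; ring
        simp [reflectionOrSwap, hx, h]
      · rcases b with _ | _ <;> rcases c with _ | _
        · exact absurd rfl hbc
        · exact ⟨.inr ⟨y - x, sub_ne_zero.2 (Ne.symm hne)⟩, by simp [reflectionOrSwap]⟩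
        · exact ⟨.inr ⟨x - y, sub_ne_zero.2 hne⟩, by simp [reflectionOrSwap]⟩
        · exact absurd rfl hbc
  apply_injective x i j h := by
    obtain ⟨x, b⟩ := x
    have hmixed : ∀ (s : ZMod p) (d : {d : ZMod p // d ≠ 0}),
        reflectionOrSwap (.inl s) (x, b) ≠ reflectionOrSwap (.inr d) (x, b) := by
      intro s d
      have hd := d.2
      intro h
      by_cases hx : x = s
      · cases b <;> simp [reflectionOrSwap, hx, hd, eq_sub_iff_add_eq] at h
      · cases b <;> simp [reflectionOrSwap, hx] at h
    rcases i with s | d <;> rcases j with t | e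
    · congr 1
      by_cases hi : x = s <;> by_cases hj : x = t
      · exact hi.symm.trans hj
      · simp [reflectionOrSwap, hi] at h
        grind
      · simp [reflectionOrSwap, hj] at h
        grind
      · simp only [reflectionOrSwap, hi, hj, if_false, Prod.mk.injEq, and_true] at h
        exact mul_left_cancel₀ h2 (by linear_combination h)
    · exact absurd h (hmixed s e)
    · exact absurd h.symm (hmixed t d)
    · congr 1
      cases b <;> simpa [reflectionOrSwap, Subtype.ext_iff] using h
  eq_univ i j hij S hS hi hj := by
    have hrefl : ∀ s, (∀ x ∈ S, reflectionOrSwap (.inl s) x ∈ S) →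
        ∀ b x, (x, b) ∈ S → (2 * s - x, b) ∈ S := by
      intro s hs b x hx
      by_cases hxs : x = s
      · subst hxs
        convert hx using 2
        ring
      · simpa [reflectionOrSwap, hxs] using hs _ hx
    have hup : ∀ d, (∀ x ∈ S, reflectionOrSwap (.inr d) x ∈ S) →
        ∀ x, (x, false) ∈ S → (x + d, true) ∈ S := fun d hd x hx => hd _ hx
    have hdown : ∀ d, (∀ x ∈ S, reflectionOrSwap (.inr d) x ∈ S) →
        ∀ x, (x, true) ∈ S → (x - d, false) ∈ S := fun d hd x hx => hd _ hx
    have hother : ∀ k, (∀ x ∈ S, reflectionOrSwap k x ∈ S) → ∀ b, (∀ x, (x, b) ∈ S) →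
        ∃ x, (x, !b) ∈ S := by
      intro k hk b hb
      rcases k with s | d
      · exact ⟨s, by simpa [reflectionOrSwap] using hk _ (hb s)⟩
      · cases b
        · exact ⟨_, hup d hk _ (hb 0)⟩
        · exact ⟨_, hdown d hk _ (hb 0)⟩
    have hmixed : ∀ s d, (∀ x ∈ S, reflectionOrSwap (.inl s) x ∈ S) →
        (∀ x ∈ S, reflectionOrSwap (.inr d) x ∈ S) →
        ∀ b, {x | (x, b) ∈ S}.Nonempty → {x | (x, b) ∈ S} = Set.univ := by
      intro s d hs hd b hb
      refine Set.eq_univ_of_add_mem_zmod hb (neg_ne_zero.2 (mul_ne_zero h2 d.2)) fun x hx => ?_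
      simp only [Set.mem_ofPred_eq] at hx ⊢
      cases b
      · convert hdown d hd _ (hrefl s hs _ _ (hup d hd _ (hrefl s hs _ _ hx))) using 2
        ring
      · convert hrefl s hs _ _ (hup d hd _ (hrefl s hs _ _ (hdown d hd _ hx))) using 2
        ring
    have hslice : ∀ b, {x | (x, b) ∈ S}.Nonempty → {x | (x, b) ∈ S} = Set.univ := by
      rcases i with s | d <;> rcases j with t | e
      · intro b hb
        exact Set.eq_univ_of_reflection_mem_zmod h2 hb (fun h => hij (by rw [h]))
          (hrefl s hi b) (hrefl t hj b)
      · exact hmixed s e hi hj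
      · exact hmixed t d hj hi
      · intro b hb
        have hde : (d : ZMod p) - e ≠ 0 := fun h => hij (by rw [Subtype.ext (sub_eq_zero.1 h)])
        cases b
        · refine Set.eq_univ_of_add_mem_zmod hb hde fun x hx => ?_
          simp only [Set.mem_ofPred_eq] at hx ⊢
          convert hdown e hj _ (hup d hi _ hx) using 2
          ring
        · refine Set.eq_univ_of_add_mem_zmod hb hde fun x hx => ?_
          simp only [Set.mem_ofPred_eq] at hx ⊢
          convert hup d hi _ (hdown e hj _ hx) using 2
          ring
    have hall : ∀ b, {x | (x, b) ∈ S}.Nonempty → ∀ x, (x, b) ∈ S := fun b hb x =>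
      (hslice b hb ▸ Set.mem_univ x : x ∈ {x | (x, b) ∈ S})
    obtain ⟨⟨x, b⟩, hx⟩ := hS
    have hb := hall b ⟨x, hx⟩
    have hb' := hall (!b) (hother i hi b hb)
    refine Set.eq_univ_of_forall fun ⟨y, c⟩ => ?_
    by_cases hc : c = b
    · exact hc ▸ hb y
    · exact Bool.eq_not.2 hc ▸ hb' y

theorem completeGraphHasPerfectOneFactorization_prime_add_one {p : ℕ} (hp : p.Prime)
    (hodd : Odd p) : CompleteGraphHasPerfectOneFactorization (p + 1) := by
  have : Fact p.Prime := ⟨hp⟩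
  exact (isPerfectInvolutionFamily_reflectionOption
    (ZMod.two_ne_zero_of_odd hodd)).completeGraphHasPerfectOneFactorization (by simp)

theorem completeGraphHasPerfectOneFactorization_two_mul_prime {p : ℕ} (hp : p.Prime)
    (hodd : Odd p) : CompleteGraphHasPerfectOneFactorization (2 * p) := by
  have : Fact p.Prime := ⟨hp⟩
  exact (isPerfectInvolutionFamily_reflectionOrSwap
    (ZMod.two_ne_zero_of_odd hodd)).completeGraphHasPerfectOneFactorization
    (by simp [mul_comm])

theorem SimpleGraph.Walk.IsCycle.exists_adj_ne {V : Type*} {G : SimpleGraph V} {a : V}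
    {p : G.Walk a a} (hp : p.IsCycle) {v : V} (hv : v ∈ p.support) :
    ∀ w, ∃ u, u ≠ w ∧ G.Adj v u := by
  intro w
  have h2 := hp.ncard_neighborSet_toSubgraph_eq_two hv
  obtain ⟨u, hu, huw⟩ := Set.exists_ne_of_one_lt_ncard (h2 ▸ one_lt_two) w
  exact ⟨u, huw, (p.toSubgraph.adj_sub hu)⟩

/-- A good family for Hamiltonian cycles is determined by the neighbourhoods of a vertex `0`
outside another vertex `1`. -/
theorem card_le_of_isGoodFamily_hamiltonianCycleClass {m : ℕ}
    {𝒢 : Finset (SimpleGraph (Fin (m + 2)))} (h𝒢 : IsGoodFamily hamiltonianCycleClass 𝒢) :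
    𝒢.card ≤ 2 ^ m := by
  classical
  let φ : SimpleGraph (Fin (m + 2)) → Finset (Fin m) := fun G =>
    Finset.univ.filter fun v => G.Adj 0 v.succ.succ
  have hinj : Set.InjOn φ 𝒢 := by
    intro G hG G' hG' hφ
    by_contra hne
    obtain ⟨a, p, hp⟩ := h𝒢 G hG G' hG' hne
    obtain ⟨u, hu, hadj⟩ := hp.isCycle.exists_adj_ne (hp.mem_support 0) 1
    obtain ⟨v, rfl⟩ := Fin.exists_succ_eq.2 hadj.ne'
    have hv : v ≠ 0 := by
      rintro rfl
      exact hu rfl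
    obtain ⟨w, rfl⟩ := Fin.exists_succ_eq.2 hv
    have hw : G.Adj 0 w.succ.succ ↔ G'.Adj 0 w.succ.succ := by
      simpa [φ] using Finset.ext_iff.1 hφ w
    simp only [symmDiff_def, sup_adj, sdiff_adj] at hadj
    tauto
  calc 𝒢.card = (𝒢.image φ).card := (Finset.card_image_of_injOn hinj).symm
    _ ≤ Fintype.card (Finset (Fin m)) := Finset.card_le_univ _
    _ = 2 ^ m := by simp

/-- The set of indices of even cardinality obtained from a set of positive indices by adding the
index `0` if necessary. -/
def evenExtension {m : ℕ} (A : Finset (Fin m)) : Finset (Fin (m + 1)) :=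
  if Even A.card then A.map (Fin.succEmb m) else insert 0 (A.map (Fin.succEmb m))

theorem succ_mem_evenExtension {m : ℕ} {A : Finset (Fin m)} {v : Fin m} :
    v.succ ∈ evenExtension A ↔ v ∈ A := by
  unfold evenExtension
  split_ifs <;> simp [Fin.succ_ne_zero]

theorem zero_mem_evenExtension {m : ℕ} {A : Finset (Fin m)} :
    0 ∈ evenExtension A ↔ ¬ Even A.card := by
  unfold evenExtension
  split_ifs with h <;> simp [h, Fin.succ_ne_zero]

theorem exists_two_mem_symmDiff_evenExtension {m : ℕ} {A B : Finset (Fin m)} (h : A ≠ B) :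
    ∃ v w, v ≠ w ∧ v ∈ evenExtension A ∆ evenExtension B ∧
      w ∈ evenExtension A ∆ evenExtension B := by
  have hmem : ∀ v : Fin m, v.succ ∈ evenExtension A ∆ evenExtension B ↔ v ∈ A ∆ B := by
    simp [Finset.mem_symmDiff, succ_mem_evenExtension]
  obtain ⟨v, hv⟩ : (A ∆ B).Nonempty := by
    rw [Finset.nonempty_iff_ne_empty]
    exact fun h' => h (symmDiff_eq_bot.1 h')
  by_cases hw : ∃ w ∈ A ∆ B, w ≠ v
  · obtain ⟨w, hw, hwv⟩ := hw
    exact ⟨v.succ, w.succ, fun h => hwv (Fin.succ_injective _ h).symm, (hmem v).2 hv, (hmem w).2 hw⟩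
  · push Not at hw
    have hs : A ∆ B = {v} := Finset.eq_singleton_iff_unique_mem.2 ⟨hv, hw⟩
    have hpar : (Even A.card ↔ ¬ Even B.card) := by
      have hAB : (A ∆ B).card = 1 := by rw [hs]; rfl
      have h1 : (A ∆ B).card = (A \ B).card + (B \ A).card :=
        Finset.card_union_of_disjoint disjoint_sdiff_sdiff
      have h2 := Finset.card_sdiff_add_card_inter A B
      have h3 := Finset.card_sdiff_add_card_inter B A
      rw [Finset.inter_comm] at h3
      rw [Nat.even_iff, Nat.even_iff]
      omega
    refine ⟨v.succ, 0, Fin.succ_ne_zero v, (hmem v).2 hv, ?_⟩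
    rw [Finset.mem_symmDiff, zero_mem_evenExtension, zero_mem_evenExtension]
    tauto

/-- The graph formed by those matchings in `ℳ` for which the vertex matched with `0` lies in
the image of `S` under `Fin.succ`. -/
def unionOfMatchings {m : ℕ} (ℳ : Set (⊤ : SimpleGraph (Fin (m + 1))).Subgraph)
    (S : Finset (Fin m)) : SimpleGraph (Fin (m + 1)) where
  Adj x y := ∃ M ∈ ℳ, M.Adj x y ∧ ∃ v ∈ S, M.Adj 0 v.succ
  symm := ⟨fun _ _ ⟨M, hM, h, hv⟩ => ⟨M, hM, h.symm, hv⟩⟩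
  loopless := ⟨fun _ ⟨_, _, h, _⟩ => h.ne rfl⟩

theorem IsPerfectOneFactorization.eq_of_adj {V : Type*} [DecidableEq V] {G : SimpleGraph V}
    {ℳ : Set G.Subgraph} (hℳ : IsPerfectOneFactorization G ℳ) {M M' : G.Subgraph} (hM : M ∈ ℳ)
    (hM' : M' ∈ ℳ) {x y : V} (h : M.Adj x y) (h' : M'.Adj x y) : M = M' :=
  (hℳ.existsUnique_mem s(x, y) h.adj_sub).unique ⟨hM, h⟩ ⟨hM', h'⟩

theorem IsPerfectOneFactorization.symmDiff_unionOfMatchings_mem {m : ℕ}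
    {ℳ : Set (⊤ : SimpleGraph (Fin (m + 1))).Subgraph}
    (hℳ : IsPerfectOneFactorization ⊤ ℳ) {S T : Finset (Fin m)} {v w : Fin m} (hvw : v ≠ w)
    (hv : v ∈ S ∆ T) (hw : w ∈ S ∆ T) :
    unionOfMatchings ℳ S ∆ unionOfMatchings ℳ T ∈ hamiltonianCycleClass (m + 1) := by
  have key : ∀ u ∈ S ∆ T, ∃ M ∈ ℳ, M.Adj 0 u.succ ∧
      ∀ x y, M.Adj x y → (unionOfMatchings ℳ S ∆ unionOfMatchings ℳ T).Adj x y := by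
    intro u hu
    obtain ⟨M, ⟨hM, hadj⟩, -⟩ := hℳ.existsUnique_mem s(0, u.succ) (Fin.succ_ne_zero u).symm
    have hadj' : M.Adj 0 u.succ := hadj
    have hiff : ∀ R : Finset (Fin m), ∀ x y, M.Adj x y →
        ((unionOfMatchings ℳ R).Adj x y ↔ u ∈ R) := by
      intro R x y hxy
      refine ⟨?_, fun h => ⟨M, hM, hxy, u, h, hadj'⟩⟩
      rintro ⟨M', hM', hxy', z, hz, hz'⟩
      obtain rfl := hℳ.eq_of_adj hM hM' hxy hxy'
      rwa [Fin.succ_injective _ ((hℳ.isPerfectMatching M hM).1.eq_of_adj_left hadj' hz')]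
    refine ⟨M, hM, hadj', fun x y hxy => ?_⟩
    rw [Finset.mem_symmDiff] at hu
    simpa only [symmDiff_def, sup_adj, sdiff_adj, hiff _ x y hxy] using hu
  obtain ⟨M, hM, hMv, hMle⟩ := key v hv
  obtain ⟨M', hM', hMw, hMle'⟩ := key w hw
  have hne : M ≠ M' := by
    rintro rfl
    exact hvw (Fin.succ_injective _ ((hℳ.isPerfectMatching M hM).1.eq_of_adj_left hMv hMw))
  obtain ⟨a, p, hp, hsub⟩ := hℳ.sup_eq_hamiltonianCycle M hM M' hM' hne
  have hedges : ∀ e ∈ p.edges, e ∈ (unionOfMatchings ℳ S ∆ unionOfMatchings ℳ T).edgeSet := by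
    intro e he
    induction e with | _ x y => ?_
    rw [← Walk.mem_edges_toSubgraph, hsub] at he
    exact (Subgraph.sup_adj.1 he).elim (hMle x y) (hMle' x y)
  exact ⟨a, p.transfer _ hedges, by
    rw [Walk.isHamiltonianCycle_iff_isCycle_and_support_count_tail_eq_one] at hp ⊢
    exact ⟨hp.1.transfer hedges, by simpa using hp.2⟩⟩

theorem IsPerfectOneFactorization.exists_isGoodFamily {m : ℕ}
    {ℳ : Set (⊤ : SimpleGraph (Fin (m + 2))).Subgraph} (hℳ : IsPerfectOneFactorization ⊤ ℳ) :
    ∃ 𝒢 : Finset (SimpleGraph (Fin (m + 2))),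
      IsGoodFamily hamiltonianCycleClass 𝒢 ∧ 𝒢.card = 2 ^ m := by
  classical
  let Φ : Finset (Fin m) → SimpleGraph (Fin (m + 2)) := fun A =>
    unionOfMatchings ℳ (evenExtension A)
  have hgood : ∀ A B, A ≠ B → Φ A ∆ Φ B ∈ hamiltonianCycleClass (m + 2) := by
    intro A B hAB
    obtain ⟨v, w, hvw, hv, hw⟩ := exists_two_mem_symmDiff_evenExtension hAB
    exact hℳ.symmDiff_unionOfMatchings_mem hvw hv hw
  have hinj : Function.Injective Φ := by
    intro A B hAB
    by_contra hne
    obtain ⟨a, p, hp⟩ := hgood A B hne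
    obtain ⟨u, -, hu⟩ := hp.isCycle.exists_adj_ne (hp.mem_support 0) 0
    rw [hAB, symmDiff_self] at hu
    exact hu
  refine ⟨Finset.univ.image Φ, ?_, ?_⟩
  · intro G hG G' hG' hne
    obtain ⟨A, -, rfl⟩ := Finset.mem_image.1 hG
    obtain ⟨B, -, rfl⟩ := Finset.mem_image.1 hG'
    exact hgood A B fun h => hne (by rw [h])
  · rw [Finset.card_image_of_injective _ hinj]
    simp

theorem CompleteGraphHasPerfectOneFactorization.maxGoodFamily_eq {n : ℕ}
    (h : CompleteGraphHasPerfectOneFactorization n) (hn : 0 < n) (heven : Even n) :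
    maxGoodFamily hamiltonianCycleClass n = 2 ^ (n - 2) := by
  obtain ⟨m, rfl⟩ : ∃ m, n = m + 2 := ⟨n - 2, by rcases heven with ⟨k, rfl⟩; omega⟩
  obtain ⟨ℳ, hℳ⟩ := h
  refine (isGreatest_maxGoodFamily _ _).unique ⟨hℳ.exists_isGoodFamily, ?_⟩
  rintro k ⟨𝒢, h𝒢, rfl⟩
  exact card_le_of_isGoodFamily_hamiltonianCycleClass h𝒢

theorem mainTheorem8 :
    (∀ n : ℕ, 0 < n → Even n → CompleteGraphHasPerfectOneFactorization n →
      maxGoodFamily hamiltonianCycleClass n = 2 ^ (n - 2)) ∧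
    (∀ p : ℕ, p.Prime → Odd p →
      (CompleteGraphHasPerfectOneFactorization (p + 1) ∧
        maxGoodFamily hamiltonianCycleClass (p + 1) = 2 ^ (p + 1 - 2)) ∧
      (CompleteGraphHasPerfectOneFactorization (2 * p) ∧
        maxGoodFamily hamiltonianCycleClass (2 * p) = 2 ^ (2 * p - 2))) := by
  refine ⟨fun n hn heven h => h.maxGoodFamily_eq hn heven, fun p hp hodd => ?_⟩
  have h₁ := completeGraphHasPerfectOneFactorization_prime_add_one hp hodd
  have h₂ := completeGraphHasPerfectOneFactorization_two_mul_prime hp hodd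
  exact ⟨⟨h₁, h₁.maxGoodFamily_eq p.succ_pos hodd.add_one⟩,
    h₂, h₂.maxGoodFamily_eq (Nat.mul_pos two_pos hp.pos) (even_two_mul p)⟩
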